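/- Let $M$ be a closed (compact, without boundary) smooth manifold of dimension $n+1$ with $3\le n+1\le 7$, and let $c>0$. For a smooth Riemannian metric $g$ on $M$ let $\mathcal H^{n+1}_g$ be its volume measure, and for a Borel set $\Omega\subset M$ and an open set $U\subset M$ let $$\|\partial\Omega\|_g(U)=\sup\Big\{\int_\Omega \operatorname{div}_g X\,d\mathcal H^{n+1}_g \;:\; X \text{ a smooth vector field with } \operatorname{supp}X\subset U,\ |X|_g\le 1\Big\},\qquad \mathbf M_g(\partial\Omega)=\|\partial\Omega\|_g(M).$$ Let $\mathcal C(M)$ be the space of Caccioppoli sets, i.e. Borel sets $\Omega$ with $\mathbf M_g(\partial\Omega)<\infty$, identified when they differ by a null set, with the flat distance $\mathcal F_g(\Omega_1,\Omega_2)=\mathcal H^{n+1}_g(\Omega_1\triangle\Omega_2)$, and for $\Omega\in\mathcal C(M)$ let $$\mathcal A^c_g(\Omega)=\mathbf M_g(\partial\Omega)-c\,\mathcal H^{n+1}_g(\Omega).$$ A sweepout of $(M,g)$ is an $\mathcal F_g$-continuous map $\phi:[0,1]\to\mathcal C(M)$ with $\phi(0)=\emptyset$, $\phi(1)=M$ and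 no concentration of mass, i.e. $$\lim_{r\to0}\ \sup\{\|\partial\phi(x)\|_g(B_r(p)) : p\in M,\ x\in[0,1]\}=0,$$ where $B_r(p)$ is the open geodesic ball of $(M,g)$. Let $\Pi_g$ be the set of all sweepouts of $(M,g)$ and $$W^c(M,g)=\inf_{\phi\in\Pi_g}\ \sup_{x\in[0,1]}\mathcal A^c_g(\phi(x)),$$ with infimum and supremum taken in $[-\infty,\infty]$. Then $g\mapsto W^c(M,g)$ is a continuous function on the space of smooth Riemannian metrics on $M$ with the $C^0$ topology. -/

import Mathlib

open Set Filter MeasureTheory Bundle Manifold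
open scoped Topology ENNReal ContDiff Manifold unitInterval

noncomputable section

namespace CMC

/-- Euclidean space of dimension `d`. -/
abbrev Eu (d : ℕ) : Type := EuclideanSpace ℝ (Fin d)

section Metrics

variable (d : ℕ) (M : Type*) [TopologicalSpace M] [ChartedSpace (Eu d) M]
  [IsManifold (𝓡 d) ∞ M]

/-- Smooth Riemannian metrics on the smooth `d`-dimensional manifold `M` (without boundary). -/
abbrev RiemMetric : Type _ :=
  ContMDiffRiemannianMetric (𝓡 d) ∞ (Eu d) (fun x : M ↦ TangentSpace (𝓡 d) x)

variable {d M}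

/-- A Riemannian metric, seen as a continuous map from `M` to the total space of the bundle of
bilinear forms on the tangent spaces. -/
def RiemMetric.toContinuousMap (g : RiemMetric d M) :
    C(M, TotalSpace (Eu d →L[ℝ] Eu d →L[ℝ] ℝ)
      (fun x : M ↦ TangentSpace (𝓡 d) x →L[ℝ] TangentSpace (𝓡 d) x →L[ℝ] ℝ)) where
  toFun x := TotalSpace.mk' (Eu d →L[ℝ] Eu d →L[ℝ] ℝ) x (g.inner x)
  continuous_toFun := g.contMDiff.continuous

/-- The `C⁰` topology on the space of Riemannian metrics: the compact-open topology on the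
sections of the bundle of bilinear forms. On a compact manifold this is the topology of uniform
convergence of the metric tensors. -/
instance c0Topology : TopologicalSpace (RiemMetric d M) :=
  TopologicalSpace.induced RiemMetric.toContinuousMap ContinuousMap.compactOpen

end Metrics

variable {d : ℕ} {M : Type*} [TopologicalSpace M] [ChartedSpace (Eu d) M]
  [IsManifold (𝓡 d) ∞ M]

/-- The coordinate vector field `∂ᵢ` of the preferred chart around `x₀`, at the point of `M` with
coordinates `y`. -/
def coordVec (x₀ : M) (i : Fin d) (y : Eu d) :
    TangentSpace (𝓡 d) ((extChartAt (𝓡 d) x₀).symm y) :=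
  mfderiv 𝓘(ℝ, Eu d) (𝓡 d) (extChartAt (𝓡 d) x₀).symm y (EuclideanSpace.single i (1 : ℝ) : Eu d)

/-- `√(det (g(∂ᵢ, ∂ⱼ)))` in the preferred chart around `x₀`, at the point with coordinates `y`. -/
def sqrtDet (g : RiemMetric d M) (x₀ : M) (y : Eu d) : ℝ :=
  √(Matrix.det (Matrix.of fun i j : Fin d ↦
    g.inner ((extChartAt (𝓡 d) x₀).symm y) (coordVec x₀ i y) (coordVec x₀ j y)))

/-- The coordinates `(X¹, …, Xᵈ)` of the vector field `X` in the preferred chart around `x₀`, at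
the point with coordinates `y`. -/
def coords (X : ∀ x : M, TangentSpace (𝓡 d) x) (x₀ : M) (y : Eu d) : Eu d :=
  mfderiv (𝓡 d) 𝓘(ℝ, Eu d) (extChartAt (𝓡 d) x₀) ((extChartAt (𝓡 d) x₀).symm y)
    (X ((extChartAt (𝓡 d) x₀).symm y))

/-- The Riemannian divergence
`div_g X = (√det g)⁻¹ ∑ᵢ ∂ᵢ(√det g Xⁱ)`, computed at `x` in the preferred chart around `x`. -/
def divergence (g : RiemMetric d M) (X : ∀ x : M, TangentSpace (𝓡 d) x) (x : M) : ℝ :=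
  (sqrtDet g x (extChartAt (𝓡 d) x x))⁻¹ *
    ∑ i : Fin d, fderiv ℝ (fun y : Eu d ↦ sqrtDet g x y * coords X x y i)
      (extChartAt (𝓡 d) x x) (EuclideanSpace.single i 1)

/-- The open geodesic ball of radius `r` around `p`, for the Riemannian distance of `g`. -/
def geodesicBall (g : RiemMetric d M) (p : M) (r : ℝ) : Set M :=
  letI : RiemannianBundle (fun x : M ↦ TangentSpace (𝓡 d) x) := ⟨g.toRiemannianMetric⟩
  {q | riemannianEDist (𝓡 d) p q < ENNReal.ofReal r}

variable [MeasurableSpace M]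

/-- The measure `√det g dy¹ … dyᵈ` on the domain of the preferred chart around `x₀`, extended by
zero to all of `M`. -/
def chartVol (g : RiemMetric d M) (x₀ : M) : Measure M :=
  Measure.map (extChartAt (𝓡 d) x₀).symm
    ((volume.restrict (extChartAt (𝓡 d) x₀).target).withDensity
      fun y ↦ ENNReal.ofReal (sqrtDet g x₀ y))

/-- The Riemannian volume measure of `g`, i.e. the `d`-dimensional Hausdorff measure of `(M, g)`:
the least measure that dominates `√det g dy¹ … dyᵈ` on every chart domain. By the change of
variables formula these chart measures agree on overlaps, so it restricts to
`√det g dy¹ … dyᵈ` on every chart domain. -/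
def vol (g : RiemMetric d M) : Measure M := ⨆ x₀ : M, chartVol g x₀

/-- The mass `𝐌_U(∂Ω) = ‖∂Ω‖(U)` of the boundary of `Ω` in the open set `U`: the supremum of
`∫_Ω div_g X` over all smooth vector fields `X` with support in `U` and `|X|_g ≤ 1`.
(On a compact manifold the support is automatically compact.) -/
def massIn (g : RiemMetric d M) (U Ω : Set M) : ℝ≥0∞ :=
  ⨆ (X : ∀ x : M, TangentSpace (𝓡 d) x)
    (_ : ContMDiff (𝓡 d) (𝓡 d).tangent ∞ (fun x ↦ (⟨x, X x⟩ : TangentBundle (𝓡 d) M)))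
    (_ : closure {x | X x ≠ 0} ⊆ U)
    (_ : ∀ x, g.inner x (X x) (X x) ≤ 1),
    ENNReal.ofReal (∫ x in Ω, divergence g X x ∂(vol g))

/-- The total mass `𝐌(∂Ω)`, i.e. the perimeter of `Ω` in `(M, g)`. -/
def mass (g : RiemMetric d M) (Ω : Set M) : ℝ≥0∞ := massIn g univ Ω

/-- Caccioppoli sets: Borel sets of finite perimeter. As usual they are identified when they
differ by a null set; everything below only depends on the class of the set. -/
def IsCaccioppoli (g : RiemMetric d M) (Ω : Set M) : Prop :=
  MeasurableSet Ω ∧ mass g Ω < ⊤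

/-- The flat distance of two Caccioppoli sets: the volume of their symmetric difference. -/
def flatDist (g : RiemMetric d M) (Ω₁ Ω₂ : Set M) : ℝ≥0∞ := vol g (symmDiff Ω₁ Ω₂)

/-- One-parameter sweepouts of `M`: flat-continuous families of Caccioppoli sets that start at
`0`, end at `M` and have no concentration of mass. -/
structure IsSweepout (g : RiemMetric d M) (φ : I → Set M) : Prop where
  caccioppoli : ∀ t, IsCaccioppoli g (φ t)
  flat_continuous : ∀ t₀, Tendsto (fun t ↦ flatDist g (φ t) (φ t₀)) (𝓝 t₀) (𝓝 0)
  zero : φ 0 =ᵐ[vol g] (∅ : Set M)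
  one : φ 1 =ᵐ[vol g] (univ : Set M)
  no_concentration :
    Tendsto (fun r : ℝ ↦ ⨆ (p : M) (t : I), massIn g (geodesicBall g p r) (φ t))
      (𝓝[>] 0) (𝓝 0)

/-- The functional `𝒜ᶜ(Ω) = 𝐌(∂Ω) - c vol(Ω)` on Caccioppoli sets. -/
def Ac (c : ℝ) (g : RiemMetric d M) (Ω : Set M) : ℝ :=
  (mass g Ω).toReal - c * (vol g Ω).toReal

/-- The `𝒜ᶜ`-min-max value `Wᶜ(M, g)`, the infimum over all sweepouts `φ` of
`sup_t 𝒜ᶜ(φ t)`; infimum and supremum are taken in the extended reals. -/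
def minMaxValue (c : ℝ) (g : RiemMetric d M) : EReal :=
  ⨅ (φ : I → Set M) (_ : IsSweepout g φ), ⨆ t : I, ((Ac c g (φ t) : ℝ) : EReal)

end CMC

end

/-!
If `g` and `g'` are `C⁰`-close, all quantities that enter the min-max value are comparable with
factors close to `1`. For lengths this is the definition. The volume measures satisfy
`vol g' = ρ • vol g` (`CMC.vol_eq_withDensity`), where the density `ρ = √(det g' / det g)` is a
smooth function with values close to `1`. Although the divergence involves derivatives of the
metric, the mass does not: the identity `ρ div_{g'} X = div_g (ρ X)`
(`CMC.density_mul_divergence`) gives `∫_Ω div_{g'} X dvol_{g'} = ∫_Ω div_g (ρ X) dvol_g`, so that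
`X ↦ ρ X`, rescaled by a constant close to `1`, takes competitors for `‖∂Ω‖_{g'}(U)` to competitors
for `‖∂Ω‖_g(U)`. This yields `CMC.AreClose.massIn_le`.

Consequently `g` and `g'` have the same sweepouts (`CMC.AreClose.isSweepout`), and
`𝒜ᶜ_{g'}(Ω) ≤ L² 𝒜ᶜ_g(Ω) + c (L² - L⁻¹) vol_g(M)` if the metrics agree up to the factor `L`
(`CMC.AreClose.Ac_le`). Taking the supremum over a sweepout and the infimum over all sweepouts, and
exchanging the roles of the metrics, one bounds each of the two min-max values by the other. That
`g` is close to `g₀` on a `C⁰` neighbourhood of `g₀`, for every `L > 1`, follows from the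
compactness of `M` and of the unit spheres (`CMC.eventually_areClose`).
-/

noncomputable section

namespace CMC

/-! ### Gram determinants -/

/-- The determinant of the Gram matrix of a bilinear form in the standard basis. -/
def gramDet {d : ℕ} (B : Eu d →L[ℝ] Eu d →L[ℝ] ℝ) : ℝ :=
  Matrix.det (Matrix.of fun i j : Fin d ↦
    B (EuclideanSpace.single i 1) (EuclideanSpace.single j 1))

theorem det_gram_comp {d : ℕ} (B : Eu d →L[ℝ] Eu d →L[ℝ] ℝ) (A : Eu d →L[ℝ] Eu d) :
    Matrix.det (Matrix.of fun i j : Fin d ↦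
      B (A (EuclideanSpace.single i 1)) (A (EuclideanSpace.single j 1))) =
      (LinearMap.det (A : Eu d →ₗ[ℝ] Eu d)) ^ 2 * gramDet B := by
  set b := (EuclideanSpace.basisFun (Fin d) ℝ).toBasis with hb
  let B' : LinearMap.BilinForm ℝ (Eu d) :=
    LinearMap.mk₂ ℝ (fun v w ↦ B v w) (by simp) (by simp) (by simp) (by simp)
  have h1 : (Matrix.of fun i j : Fin d ↦
      B (A (EuclideanSpace.single i 1)) (A (EuclideanSpace.single j 1))) =
      LinearMap.BilinForm.toMatrix b (B'.comp A A) := by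
    ext i j; simp [LinearMap.BilinForm.toMatrix_apply, b, B']
  have h2 : (Matrix.of fun i j : Fin d ↦
      B (EuclideanSpace.single i 1) (EuclideanSpace.single j 1)) =
      LinearMap.BilinForm.toMatrix b B' := by
    ext i j; simp [LinearMap.BilinForm.toMatrix_apply, b, B']
  rw [gramDet, h1, h2, LinearMap.BilinForm.toMatrix_comp b b]
  simp [LinearMap.det_toMatrix]
  ring

theorem gramDet_pos {d : ℕ} (B : Eu d →L[ℝ] Eu d →L[ℝ] ℝ) (hs : ∀ v w, B v w = B w v)
    (hp : ∀ v, v ≠ 0 → 0 < B v v) : 0 < gramDet B := by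
  refine Matrix.PosDef.det_pos (Matrix.PosDef.of_dotProduct_mulVec_pos ?_ fun x hx ↦ ?_)
  · ext i j
    simp [hs (EuclideanSpace.single i 1)]
  · have hsum : ∑ i, x i • EuclideanSpace.single i (1 : ℝ) = WithLp.toLp 2 x := by
      ext j
      simp [Pi.single_apply]
    have h := hp (WithLp.toLp 2 x) (by simpa using hx)
    rw [← hsum] at h
    convert! h using 1
    simp [dotProduct, Matrix.mulVec, Finset.mul_sum]
    refine Finset.sum_comm.trans ?_
    refine Finset.sum_congr rfl fun i _ ↦ Finset.sum_congr rfl fun j _ ↦ ?_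
    ring

variable {d : ℕ} {M : Type*} [TopologicalSpace M] [ChartedSpace (Eu d) M]
  [IsManifold (𝓡 d) ∞ M]

/-- The Gram determinant of the metric `g` at `x`, in the basis of the tangent space given by its
identification with the model space. -/
def detAt (g : RiemMetric d M) (x : M) : ℝ := gramDet (d := d) (g.inner x)

theorem detAt_pos (g : RiemMetric d M) (x : M) : 0 < detAt g x :=
  gramDet_pos (d := d) (g.inner x) (g.symm x) (g.pos x)

/-- The density of the volume of `g'` with respect to the volume of `g`. It is a quotient of Gram
determinants in a common basis, hence independent of the basis. -/
def density (g g' : RiemMetric d M) (x : M) : ℝ := √(detAt g' x) / √(detAt g x)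

theorem density_pos (g g' : RiemMetric d M) (x : M) : 0 < density g g' x :=
  div_pos (Real.sqrt_pos.2 (detAt_pos g' x)) (Real.sqrt_pos.2 (detAt_pos g x))

/-- A frame of the tangent space at `x` is given by the images of the standard basis under a linear
map `A`; its Gram determinant is that of the standard basis times `(det A) ^ 2`. -/
theorem sqrt_det_gram (g : RiemMetric d M) (x : M) (A : Eu d →L[ℝ] Eu d) :
    √(Matrix.det (Matrix.of fun i j : Fin d ↦
      g.inner x (A (EuclideanSpace.single i 1)) (A (EuclideanSpace.single j 1)))) =
    |LinearMap.det (A : Eu d →ₗ[ℝ] Eu d)| * √(detAt g x) := by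
  have := det_gram_comp (d := d) (g.inner x) A
  rw [← Real.sqrt_sq_eq_abs, ← Real.sqrt_mul (sq_nonneg _)]
  exact congrArg _ this

theorem sqrt_det_gram_eq_density_mul (g g' : RiemMetric d M) (x : M)
    (A : Eu d →L[ℝ] Eu d) :
    √(Matrix.det (Matrix.of fun i j : Fin d ↦
      g'.inner x (A (EuclideanSpace.single i 1)) (A (EuclideanSpace.single j 1)))) =
    density g g' x * √(Matrix.det (Matrix.of fun i j : Fin d ↦
      g.inner x (A (EuclideanSpace.single i 1)) (A (EuclideanSpace.single j 1)))) := by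
  have h : √(detAt g x) ≠ 0 := (Real.sqrt_pos.2 (detAt_pos g x)).ne'
  rw [sqrt_det_gram, sqrt_det_gram, density]
  field_simp

theorem sqrtDet_eq_density_mul (g g' : RiemMetric d M) (x₀ : M) (y : Eu d) :
    sqrtDet g' x₀ y = density g g' ((extChartAt (𝓡 d) x₀).symm y) * sqrtDet g x₀ y :=
  sqrt_det_gram_eq_density_mul g g' _
    (mfderiv 𝓘(ℝ, Eu d) (𝓡 d) (extChartAt (𝓡 d) x₀).symm y)

/-! ### Smoothness of the density -/

theorem contMDiffOn_trivialization_symm (x₀ : M) (v : Eu d) :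
    ContMDiffOn (𝓡 d) (𝓡 d).tangent ∞
      (fun x ↦ (⟨x, (trivializationAt (Eu d) (TangentSpace (𝓡 d)) x₀).symm x v⟩ :
        TangentBundle (𝓡 d) M))
      (trivializationAt (Eu d) (TangentSpace (𝓡 d)) x₀).baseSet := by
  set e := trivializationAt (Eu d) (TangentSpace (𝓡 d) (M := M)) x₀
  have h := e.contMDiffOn_symm (IB := 𝓡 d) (n := ∞)
  have h2 : ContMDiffOn (𝓡 d) ((𝓡 d).prod 𝓘(ℝ, Eu d)) ∞ (fun x : M ↦ (x, v)) e.baseSet :=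
    contMDiffOn_id.prodMk contMDiffOn_const
  refine (h.comp h2 fun x hx ↦ e.mem_target.2 hx).congr fun x hx ↦ ?_
  exact e.mk_symm hx v

theorem contMDiffAt_inner {N : Type*} {F H : Type*} [NormedAddCommGroup F] [NormedSpace ℝ F]
    [TopologicalSpace H] {J : ModelWithCorners ℝ F H} [TopologicalSpace N] [ChartedSpace H N]
    (g : RiemMetric d M) {f : N → M} {X Y : ∀ z, TangentSpace (𝓡 d) (f z)} {z₀ : N}
    (hX : ContMDiffAt J (𝓡 d).tangent ∞ (fun z ↦ (⟨f z, X z⟩ : TangentBundle (𝓡 d) M)) z₀)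
    (hY : ContMDiffAt J (𝓡 d).tangent ∞ (fun z ↦ (⟨f z, Y z⟩ : TangentBundle (𝓡 d) M)) z₀) :
    ContMDiffAt J 𝓘(ℝ) ∞ (fun z ↦ g.inner (f z) (X z) (Y z)) z₀ := by
  let : RiemannianBundle (fun x : M ↦ TangentSpace (𝓡 d) x) := ⟨g.toRiemannianMetric⟩
  exact ContMDiffAt.inner_bundle (IB := 𝓡 d) (F := Eu d)
    (E := fun x : M ↦ TangentSpace (𝓡 d) x) hX hY

theorem contMDiffAt_det {N : Type*} {F H : Type*} [NormedAddCommGroup F] [NormedSpace ℝ F]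
    [TopologicalSpace H] {J : ModelWithCorners ℝ F H} [TopologicalSpace N] [ChartedSpace H N]
    {a : N → Fin d → Fin d → ℝ} {z₀ : N}
    (ha : ∀ i j, ContMDiffAt J 𝓘(ℝ) ∞ (fun z ↦ a z i j) z₀) :
    ContMDiffAt J 𝓘(ℝ) ∞ (fun z ↦ Matrix.det (Matrix.of fun i j ↦ a z i j)) z₀ := by
  simp only [Matrix.det_apply']
  refine contMDiffAt_finsetSum fun τ _ ↦ contMDiffAt_const.mul ?_
  exact contMDiffAt_finsetProd fun i _ ↦ ha _ _

/-- Near `x₀` the density is the quotient of the Gram determinants of `g'` and `g` in the smooth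
frame of the trivialization around `x₀`. -/
theorem contMDiff_density (g g' : RiemMetric d M) :
    ContMDiff (𝓡 d) 𝓘(ℝ) ∞ (density g g') := by
  intro x₀
  set e := trivializationAt (Eu d) (TangentSpace (𝓡 d) (M := M)) x₀
  have hx₀ : x₀ ∈ e.baseSet := FiberBundle.mem_baseSet_trivializationAt' x₀
  have hnhds : e.baseSet ∈ 𝓝 x₀ := e.open_baseSet.mem_nhds hx₀
  let D : RiemMetric d M → M → ℝ := fun g x ↦ Matrix.det (Matrix.of fun i j : Fin d ↦
      g.inner x (e.symmL ℝ x (EuclideanSpace.single i 1))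
        (e.symmL ℝ x (EuclideanSpace.single j 1)))
  have hD : ∀ g, ContMDiffAt (𝓡 d) 𝓘(ℝ) ∞ (D g) x₀ := by
    intro g
    refine contMDiffAt_det (a := fun x i j ↦ g.inner x (e.symmL ℝ x (EuclideanSpace.single i 1))
        (e.symmL ℝ x (EuclideanSpace.single j 1))) fun i j ↦ ?_
    have key : ∀ v : Eu d, ContMDiffAt (𝓡 d) (𝓡 d).tangent ∞
        (fun x ↦ (⟨x, e.symmL ℝ x v⟩ : TangentBundle (𝓡 d) M)) x₀ := by
      intro v
      refine ((contMDiffOn_trivialization_symm x₀ v).congr fun x hx ↦ ?_).contMDiffAt hnhds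
      rw [e.symmL_apply hx]
    exact contMDiffAt_inner g (key _) (key _)
  have hpos : ∀ g : RiemMetric d M, ∀ x ∈ e.baseSet, 0 < √(D g x) := by
    intro g x hx
    let A : Eu d ≃L[ℝ] Eu d := (e.continuousLinearEquivAt ℝ x hx).symm
    have hA : ∀ v, e.symmL ℝ x v = A v := fun v ↦ e.symmL_apply hx v
    have hdet : LinearMap.det ((A : Eu d →L[ℝ] Eu d) : Eu d →ₗ[ℝ] Eu d) ≠ 0 :=
      (LinearEquiv.isUnit_det' A.toLinearEquiv).ne_zero
    have := sqrt_det_gram g x (A : Eu d →L[ℝ] Eu d)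
    simp only [D, hA]
    exact this.symm ▸ mul_pos (abs_pos.2 hdet) (Real.sqrt_pos.2 (detAt_pos g x))
  have hsqrt : ∀ g, ContMDiffAt (𝓡 d) 𝓘(ℝ) ∞ (fun x ↦ √(D g x)) x₀ := fun g ↦
    (Real.contDiffAt_sqrt (Real.sqrt_pos.1 (hpos g x₀ hx₀)).ne').contMDiffAt.comp x₀ (hD g)
  have hev : density g g' =ᶠ[𝓝 x₀] fun x ↦ √(D g' x) / √(D g x) := by
    filter_upwards [hnhds] with x hx
    rw [eq_div_iff (hpos g x hx).ne']
    exact (sqrt_det_gram_eq_density_mul g g' x (e.symmL ℝ x)).symm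
  exact ((hsqrt g').div₀ (hsqrt g) (hpos g x₀ hx₀).ne').congr_of_eventuallyEq hev

/-! ### The volume density in a chart -/

theorem continuousOn_coordVec (x₀ : M) (i : Fin d) :
    ContinuousOn (fun y ↦ (⟨(extChartAt (𝓡 d) x₀).symm y, coordVec x₀ i y⟩ :
      TangentBundle (𝓡 d) M)) (extChartAt (𝓡 d) x₀).target := by
  have hopen : IsOpen (extChartAt (𝓡 d) x₀).target := isOpen_extChartAt_target x₀
  have h := (contMDiffOn_extChartAt_symm (n := ∞) x₀).continuousOn_tangentMapWithin
    (by exact_mod_cast le_top) hopen.uniqueMDiffOn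
  have h2 : Continuous (fun y : Eu d ↦ (⟨y, EuclideanSpace.single i (1 : ℝ)⟩ :
      TangentBundle 𝓘(ℝ, Eu d) (Eu d))) :=
    (tangentBundleModelSpaceHomeomorph 𝓘(ℝ, Eu d)).symm.continuous.comp
      (continuous_id.prodMk continuous_const)
  refine (h.comp h2.continuousOn fun y hy ↦ hy).congr fun y hy ↦ ?_
  simp only [Function.comp, tangentMapWithin, coordVec, mfderivWithin_of_isOpen hopen hy]

theorem continuousOn_sqrtDet (g : RiemMetric d M) (x₀ : M) :
    ContinuousOn (sqrtDet g x₀) (extChartAt (𝓡 d) x₀).target := by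
  let : RiemannianBundle (fun x : M ↦ TangentSpace (𝓡 d) x) := 
    ⟨g.toContinuousRiemannianMetric.toRiemannianMetric⟩
  have h : ∀ i j, ContinuousOn (fun y ↦ g.inner ((extChartAt (𝓡 d) x₀).symm y)
      (coordVec x₀ i y) (coordVec x₀ j y)) (extChartAt (𝓡 d) x₀).target := fun i j ↦
    ContinuousOn.inner_bundle (F := Eu d) (E := fun x : M ↦ TangentSpace (𝓡 d) x)
      (continuousOn_coordVec x₀ i) (continuousOn_coordVec x₀ j)
  refine Real.continuous_sqrt.comp_continuousOn ?_
  simp only [Matrix.det_apply', Matrix.of_apply]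
  exact continuousOn_finsetSum _ fun τ _ ↦ continuousOn_const.mul
    (continuousOn_finsetProd _ fun i _ ↦ h _ _)

/-- Multiplication by a density with values in `(0, ∞)` is an order isomorphism on measures, so it
commutes with suprema. -/
theorem withDensity_iSup_measure {α ι : Type*} [MeasurableSpace α] (μ : ι → Measure α)
    {f : α → ℝ≥0∞} (hf : Measurable f) (h0 : ∀ x, f x ≠ 0) (ht : ∀ x, f x ≠ ⊤) :
    (⨆ i, μ i).withDensity f = ⨆ i, (μ i).withDensity f := by
  have mono : ∀ {h : α → ℝ≥0∞} {ν ν' : Measure α}, ν ≤ ν' →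
      ν.withDensity h ≤ ν'.withDensity h := by
    intro h ν ν' hν
    refine Measure.le_iff.2 fun s hs ↦ ?_
    rw [withDensity_apply _ hs, withDensity_apply _ hs]
    exact lintegral_mono' (Measure.restrict_mono le_rfl hν) le_rfl
  refine le_antisymm ?_ (iSup_le fun i ↦ mono (le_iSup μ i))
  have hinv : ∀ ν : Measure α, (ν.withDensity fun x ↦ (f x)⁻¹).withDensity f = ν := fun ν ↦ by
    have := withDensity_inv_same (μ := ν) hf.inv (ae_of_all _ fun x ↦ ENNReal.inv_ne_zero.2 (ht x))
      (ae_of_all _ fun x ↦ ENNReal.inv_ne_top.2 (h0 x))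
    simpa only [Pi.inv_apply, inv_inv] using! this
  rw [← hinv (⨆ i, (μ i).withDensity f)]
  refine mono (iSup_le fun i ↦ ?_)
  rw [← withDensity_inv_same (μ := μ i) hf (ae_of_all _ h0) (ae_of_all _ ht)]
  exact mono (le_iSup (fun i ↦ (μ i).withDensity f) i)

/-! ### Change of the divergence -/

/-- The identity `ρ div_{g'} X = div_g (ρ X)`, where `ρ` is the density of the volume of `g'` with
respect to that of `g`. It involves no derivative of `g'`, which is what makes the mass depend on
the metric only through its `C⁰` size. -/
theorem density_mul_divergence (g g' : RiemMetric d M) (X : ∀ x : M, TangentSpace (𝓡 d) x)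
    (x : M) :
    density g g' x * divergence g' X x = divergence g (fun z ↦ density g g' z • X z) x := by
  have h1 : ∀ y i, sqrtDet g' x y * coords X x y i =
      sqrtDet g x y * coords (fun z ↦ density g g' z • X z) x y i := by
    intro y i
    have : coords (fun z ↦ density g g' z • X z) x y =
        density g g' ((extChartAt (𝓡 d) x).symm y) • coords X x y :=
      (mfderiv (𝓡 d) 𝓘(ℝ, Eu d) (extChartAt (𝓡 d) x) _).map_smul _ _
    rw [this, sqrtDet_eq_density_mul g g']
    simp only [PiLp.smul_apply, smul_eq_mul]
    ring
  have h2 := sqrtDet_eq_density_mul g g' x (extChartAt (𝓡 d) x x)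
  rw [extChartAt_to_inv] at h2
  simp only [divergence, h1, h2]
  rw [mul_inv, ← mul_assoc, ← mul_assoc, mul_inv_cancel₀ (density_pos g g' x).ne', one_mul]

theorem divergence_const_smul (g : RiemMetric d M) (X : ∀ x : M, TangentSpace (𝓡 d) x) (a : ℝ)
    (x : M) : divergence g (fun z ↦ a • X z) x = a * divergence g X x := by
  have h1 : ∀ i, (fun y ↦ sqrtDet g x y * coords (fun z ↦ a • X z) x y i) =
      fun y ↦ a • (sqrtDet g x y * coords X x y i) := by
    intro i
    ext y
    have : coords (fun z ↦ a • X z) x y = a • coords X x y :=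
      (mfderiv (𝓡 d) 𝓘(ℝ, Eu d) (extChartAt (𝓡 d) x) _).map_smul _ _
    rw [this]
    simp only [PiLp.smul_apply, smul_eq_mul]
    ring
  simp only [divergence, h1]
  have h2 : ∀ i, fderiv ℝ (fun y ↦ a • (sqrtDet g x y * coords X x y i)) (extChartAt (𝓡 d) x x) =
      a • fderiv ℝ (fun y ↦ sqrtDet g x y * coords X x y i) (extChartAt (𝓡 d) x x) :=
    fun i ↦ congrFun (fderiv_const_smul_field a) _
  simp only [h2]
  simp only [smul_apply, smul_eq_mul, ← Finset.mul_sum]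
  ring

/-! ### Metrics that are close to each other -/

variable (d M) in
/-- The quadratic forms and the Gram determinants of the metrics `g` and `g'` agree up to the
factor `L ^ 2`, i.e. lengths and volume densities agree up to the factor `L`. -/
structure AreClose (L : ℝ) (g g' : RiemMetric d M) : Prop where
  inner_le : ∀ x (v : TangentSpace (𝓡 d) x), g.inner x v v ≤ L ^ 2 * g'.inner x v v
  inner_le' : ∀ x (v : TangentSpace (𝓡 d) x), g'.inner x v v ≤ L ^ 2 * g.inner x v v
  det_le : ∀ x, detAt g x ≤ L ^ 2 * detAt g' x
  det_le' : ∀ x, detAt g' x ≤ L ^ 2 * detAt g x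

/-- The norm of a tangent vector for the metric `g`. -/
def enormOf (g : RiemMetric d M) {x : M} (v : TangentSpace (𝓡 d) x) : ℝ≥0∞ :=
  letI : RiemannianBundle (fun x : M ↦ TangentSpace (𝓡 d) x) := ⟨g.toRiemannianMetric⟩
  ‖v‖ₑ

/-- The Riemannian distance of the metric `g`. -/
def edistOf (g : RiemMetric d M) (p q : M) : ℝ≥0∞ :=
  letI : RiemannianBundle (fun x : M ↦ TangentSpace (𝓡 d) x) := ⟨g.toRiemannianMetric⟩
  riemannianEDist (𝓡 d) p q

theorem edistOf_eq (g : RiemMetric d M) (p q : M) :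
    edistOf g p q = ⨅ (γ : Path p q) (_ : ContMDiff (𝓡∂ 1) (𝓡 d) 1 γ),
      ∫⁻ t, enormOf g (mfderiv (𝓡∂ 1) (𝓡 d) γ t 1) := by
  rw [edistOf, riemannianEDist]
  rfl

namespace AreClose

variable {L : ℝ} {g g' : RiemMetric d M}

theorem symm (h : AreClose d M L g g') : AreClose d M L g' g :=
  ⟨h.inner_le', h.inner_le, h.det_le', h.det_le⟩

theorem density_le (hL : 0 ≤ L) (h : AreClose d M L g g') (x : M) : density g g' x ≤ L := by
  rw [density, div_le_iff₀ (Real.sqrt_pos.2 (detAt_pos g x))]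
  calc √(detAt g' x) ≤ √(L ^ 2 * detAt g x) := Real.sqrt_le_sqrt (h.det_le' x)
    _ = L * √(detAt g x) := by rw [Real.sqrt_mul (sq_nonneg L), Real.sqrt_sq hL]

theorem enormOf_le (hL : 0 ≤ L) (h : AreClose d M L g g') (x : M) (v : TangentSpace (𝓡 d) x) :
    enormOf g v ≤ ENNReal.ofReal L * enormOf g' v := by
  have hn : ∀ g : RiemMetric d M, enormOf g v = ENNReal.ofReal √(g.inner x v v) := by
    intro g
    let : RiemannianBundle (fun x : M ↦ TangentSpace (𝓡 d) x) := ⟨g.toRiemannianMetric⟩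
    change ‖v‖ₑ = _
    rw [← ofReal_norm, norm_eq_sqrt_real_inner]
    rfl
  rw [hn, hn, ← ENNReal.ofReal_mul hL]
  refine ENNReal.ofReal_le_ofReal ?_
  calc √(g.inner x v v) ≤ √(L ^ 2 * g'.inner x v v) := Real.sqrt_le_sqrt (h.inner_le x v)
    _ = _ := by rw [Real.sqrt_mul (sq_nonneg L), Real.sqrt_sq hL]

theorem edistOf_le (hL : 0 < L) (h : AreClose d M L g g') (p q : M) :
    edistOf g p q ≤ ENNReal.ofReal L * edistOf g' p q := by
  have hL0 : ENNReal.ofReal L ≠ 0 := (ENNReal.ofReal_pos.2 hL).ne'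
  rw [edistOf_eq, edistOf_eq, ENNReal.mul_iInf_of_ne hL0 ENNReal.ofReal_ne_top]
  refine iInf_mono fun γ ↦ ?_
  rw [ENNReal.mul_iInf_of_ne hL0 ENNReal.ofReal_ne_top]
  refine iInf_mono fun _ ↦ ?_
  rw [← lintegral_const_mul' _ _ ENNReal.ofReal_ne_top]
  exact lintegral_mono fun t ↦ h.enormOf_le hL.le _ _

theorem geodesicBall_subset (hL : 0 < L) (h : AreClose d M L g g') (p : M) (r : ℝ) :
    geodesicBall g' p r ⊆ geodesicBall g p (L * r) := by
  intro q (hq : edistOf g' p q < ENNReal.ofReal r)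
  change edistOf g p q < ENNReal.ofReal (L * r)
  rw [ENNReal.ofReal_mul hL.le]
  exact (h.edistOf_le hL p q).trans_lt
    (ENNReal.mul_lt_mul_right (ENNReal.ofReal_pos.2 hL).ne' ENNReal.ofReal_ne_top hq)

end AreClose

/-! ### Change of the volume measure -/

section Measure

variable [MeasurableSpace M]

theorem measurable_density [BorelSpace M] (g g' : RiemMetric d M) : Measurable (density g g') :=
  (contMDiff_density g g').continuous.measurable

/-- The coordinate expressions of the two volumes differ by the factor `density g g'`, which does
not depend on the chart. -/
theorem chartVol_eq_withDensity [BorelSpace M] (g g' : RiemMetric d M) (x₀ : M) :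
    chartVol g' x₀ = (chartVol g x₀).withDensity fun x ↦ ENNReal.ofReal (density g g' x) := by
  have hmeas := (measurable_density g g').ennreal_ofReal
  have hT : MeasurableSet (extChartAt (𝓡 d) x₀).target :=
    (isOpen_extChartAt_target x₀).measurableSet
  have hφ : AEMeasurable (extChartAt (𝓡 d) x₀).symm
      (volume.restrict (extChartAt (𝓡 d) x₀).target) :=
    (continuousOn_extChartAt_symm x₀).aemeasurable hT
  have hs : AEMeasurable (fun y ↦ ENNReal.ofReal (sqrtDet g x₀ y))
      (volume.restrict (extChartAt (𝓡 d) x₀).target) :=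
    ((continuousOn_sqrtDet g x₀).aemeasurable hT).ennreal_ofReal
  have h : (fun y ↦ ENNReal.ofReal (sqrtDet g' x₀ y)) =
      (fun y ↦ ENNReal.ofReal (sqrtDet g x₀ y)) *
        fun y ↦ ENNReal.ofReal (density g g' ((extChartAt (𝓡 d) x₀).symm y)) := by
    ext y
    rw [Pi.mul_apply, mul_comm, sqrtDet_eq_density_mul g g',
      ENNReal.ofReal_mul (density_pos g g' _).le]
  have hφ' : AEMeasurable (extChartAt (𝓡 d) x₀).symm
      ((volume.restrict (extChartAt (𝓡 d) x₀).target).withDensity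
        fun y ↦ ENNReal.ofReal (sqrtDet g x₀ y)) :=
    hφ.mono_ac (withDensity_absolutelyContinuous _ _)
  ext s hs'
  have hm := withDensity_mul₀ hs (hmeas.comp_aemeasurable hφ)
  simp only [Function.comp_def] at hm
  rw [chartVol, chartVol, h, hm,
    withDensity_apply _ hs', Measure.map_apply_of_aemeasurable
      (hφ'.mono_ac (withDensity_absolutelyContinuous _ _)) hs',
    Measure.restrict_map_of_aemeasurable hφ' hs',
    lintegral_map' hmeas.aemeasurable hφ'.restrict, withDensity_apply₀]
  exact hφ'.nullMeasurableSet_preimage hs'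

theorem vol_eq_withDensity [BorelSpace M] (g g' : RiemMetric d M) :
    vol g' = (vol g).withDensity fun x ↦ ENNReal.ofReal (density g g' x) := by
  rw [vol, vol, withDensity_iSup_measure _ (measurable_density g g').ennreal_ofReal]
  · exact iSup_congr fun x₀ ↦ chartVol_eq_withDensity g g' x₀
  · exact fun x ↦ (ENNReal.ofReal_pos.2 (density_pos g g' x)).ne'
  · exact fun x ↦ ENNReal.ofReal_ne_top

theorem vol_absolutelyContinuous [BorelSpace M] (g g' : RiemMetric d M) : vol g' ≪ vol g := by
  rw [vol_eq_withDensity g g']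
  exact withDensity_absolutelyContinuous _ _

/-- No integrability is needed: both integrands agree after multiplication by the density, so the
two integrals are either both genuine or both zero by convention. -/
theorem setIntegral_divergence [BorelSpace M] (g g' : RiemMetric d M)
    (X : ∀ x : M, TangentSpace (𝓡 d) x) {Ω : Set M} (hΩ : MeasurableSet Ω) :
    ∫ x in Ω, divergence g' X x ∂(vol g') =
      ∫ x in Ω, divergence g (fun z ↦ density g g' z • X z) x ∂(vol g) := by
  rw [vol_eq_withDensity g g', setIntegral_withDensity_eq_setIntegral_toReal_smul
    (measurable_density g g').ennreal_ofReal (ae_of_all _ fun x ↦ ENNReal.ofReal_lt_top) _ hΩ]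
  simp only [ENNReal.toReal_ofReal (density_pos g g' _).le, smul_eq_mul, density_mul_divergence]

theorem massIn_mono (g : RiemMetric d M) {U V : Set M} (h : U ⊆ V) (Ω : Set M) :
    massIn g U Ω ≤ massIn g V Ω :=
  iSup₂_mono fun _ _ ↦ iSup_mono' fun hU ↦ ⟨hU.trans h, le_rfl⟩

variable [BorelSpace M]

namespace AreClose

variable {L : ℝ} {g g' : RiemMetric d M}

theorem vol_le (hL : 0 ≤ L) (h : AreClose d M L g g') (s : Set M) :
    vol g' s ≤ ENNReal.ofReal L * vol g s := by
  have : vol g' ≤ ENNReal.ofReal L • vol g := by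
    rw [vol_eq_withDensity g g', ← withDensity_const]
    exact withDensity_mono (ae_of_all _ fun x ↦ ENNReal.ofReal_le_ofReal (h.density_le hL x))
  exact this s

/-- A vector field `X` that competes for the mass with respect to `g'` gives the competitor
`L⁻² ρ X` for the mass with respect to `g`, where `ρ ≤ L` is the volume density. -/
theorem massIn_le (hL : 0 < L) (h : AreClose d M L g g') (U : Set M) {Ω : Set M}
    (hΩ : MeasurableSet Ω) :
    massIn g' U Ω ≤ ENNReal.ofReal (L ^ 2) * massIn g U Ω := by
  have hL2 : (0 : ℝ) < L ^ 2 := by positivity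
  refine iSup_le fun X ↦ iSup_le fun hX ↦ iSup_le fun hU ↦ iSup_le fun hb ↦ ?_
  let Y : ∀ x : M, TangentSpace (𝓡 d) x := fun x ↦ density g g' x • X x
  have hY : ContMDiff (𝓡 d) (𝓡 d).tangent ∞ (fun x ↦ (⟨x, Y x⟩ : TangentBundle (𝓡 d) M)) :=
    (contMDiff_density g g').smul_section hX
  let Z : ∀ x : M, TangentSpace (𝓡 d) x := fun x ↦ (L ^ 2)⁻¹ • Y x
  have hZ : ContMDiff (𝓡 d) (𝓡 d).tangent ∞ (fun x ↦ (⟨x, Z x⟩ : TangentBundle (𝓡 d) M)) :=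
    hY.const_smul_section
  have hZU : closure {x | Z x ≠ 0} ⊆ U := by
    refine (closure_mono fun x hx ↦ ?_).trans hU
    intro h0
    exact hx (by simp [Z, Y, h0])
  have hZ1 : ∀ x, g.inner x (Z x) (Z x) ≤ 1 := by
    intro x
    have e : g.inner x (Z x) (Z x) =
        ((L ^ 2)⁻¹ * density g g' x) ^ 2 * g.inner x (X x) (X x) := by
      simp only [Z, Y, map_smul, smul_apply, smul_eq_mul]
      ring
    have h1 : g.inner x (X x) (X x) ≤ L ^ 2 * 1 :=
      (h.inner_le x (X x)).trans (mul_le_mul_of_nonneg_left (hb x) hL2.le)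
    have h2 : (L ^ 2)⁻¹ * density g g' x ≤ L⁻¹ := by
      rw [inv_mul_le_iff₀ hL2]
      refine (h.density_le hL.le x).trans_eq ?_
      field_simp
    have h3 : 0 ≤ (L ^ 2)⁻¹ * density g g' x :=
      mul_nonneg (inv_nonneg.2 hL2.le) (density_pos g g' x).le
    calc g.inner x (Z x) (Z x) ≤ (L⁻¹) ^ 2 * (L ^ 2 * 1) := by
          rw [e]
          refine (mul_le_mul_of_nonneg_left h1 (sq_nonneg _)).trans ?_
          exact mul_le_mul_of_nonneg_right (pow_le_pow_left₀ h3 h2 2) (by positivity)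
      _ = 1 := by field_simp
  have hint : ∫ x in Ω, divergence g' X x ∂(vol g') =
      L ^ 2 * ∫ x in Ω, divergence g Z x ∂(vol g) := by
    rw [setIntegral_divergence g g' X hΩ]
    simp only [Z, divergence_const_smul, integral_const_mul]
    rw [mul_inv_cancel_left₀ hL2.ne']
  rw [hint, ENNReal.ofReal_mul hL2.le]
  refine mul_le_mul_right ?_ _
  exact le_iSup_of_le Z (le_iSup_of_le hZ (le_iSup_of_le hZU (le_iSup_of_le hZ1 le_rfl)))

theorem mass_le (hL : 0 < L) (h : AreClose d M L g g') {Ω : Set M} (hΩ : MeasurableSet Ω) :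
    mass g' Ω ≤ ENNReal.ofReal (L ^ 2) * mass g Ω :=
  h.massIn_le hL univ hΩ

theorem isCaccioppoli (hL : 0 < L) (h : AreClose d M L g g') {Ω : Set M}
    (hΩ : IsCaccioppoli g Ω) : IsCaccioppoli g' Ω :=
  ⟨hΩ.1, (h.mass_le hL hΩ.1).trans_lt (ENNReal.mul_lt_top ENNReal.ofReal_lt_top hΩ.2)⟩

/-- Flat continuity and the boundary conditions transfer by comparison of the volumes. Absence of
concentration transfers because the geodesic `r`-balls of `g'` lie in the geodesic `L r`-balls of
`g`. -/
theorem isSweepout (hL : 0 < L) (h : AreClose d M L g g') {φ : I → Set M}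
    (hφ : IsSweepout g φ) : IsSweepout g' φ where
  caccioppoli t := h.isCaccioppoli hL (hφ.caccioppoli t)
  flat_continuous t₀ := by
    have := ENNReal.Tendsto.const_mul (a := ENNReal.ofReal L) (hφ.flat_continuous t₀)
      (Or.inr ENNReal.ofReal_ne_top)
    rw [mul_zero] at this
    exact tendsto_of_tendsto_of_tendsto_of_le_of_le tendsto_const_nhds this
      (fun _ ↦ zero_le) fun t ↦ h.vol_le hL.le _
  zero := (vol_absolutelyContinuous g g').ae_le hφ.zero
  one := (vol_absolutelyContinuous g g').ae_le hφ.one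
  no_concentration := by
    have hr : Tendsto (fun r : ℝ ↦ L * r) (𝓝[>] 0) (𝓝[>] 0) := by
      refine tendsto_nhdsWithin_iff.2 ⟨?_, ?_⟩
      · have : Tendsto (fun r : ℝ ↦ L * r) (𝓝 0) (𝓝 (L * 0)) := tendsto_id.const_mul L
        rw [mul_zero] at this
        exact this.mono_left nhdsWithin_le_nhds
      · filter_upwards [self_mem_nhdsWithin] with r hr using mul_pos hL hr
    have := ENNReal.Tendsto.const_mul (a := ENNReal.ofReal (L ^ 2))
      (hφ.no_concentration.comp hr) (Or.inr ENNReal.ofReal_ne_top)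
    rw [mul_zero] at this
    refine tendsto_of_tendsto_of_tendsto_of_le_of_le tendsto_const_nhds this
      (fun _ ↦ zero_le) fun r ↦ iSup₂_le fun p t ↦ ?_
    refine (h.massIn_le hL _ (hφ.caccioppoli t).1).trans (mul_le_mul_right ?_ _)
    exact (massIn_mono g (h.geodesicBall_subset hL p r) _).trans
      (le_iSup₂ (f := fun p t ↦ massIn g (geodesicBall g p (L * r)) (φ t)) p t)

end AreClose

end Measure

/-! ### Neighbourhoods in the `C⁰` topology -/

variable (d M) in
/-- The total space of the bundle of bilinear forms on the tangent spaces. -/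
abbrev BilinTotal : Type _ :=
  TotalSpace (Eu d →L[ℝ] Eu d →L[ℝ] ℝ)
    (fun x : M ↦ TangentSpace (𝓡 d) x →L[ℝ] TangentSpace (𝓡 d) x →L[ℝ] ℝ)

/-- The bilinear form `p`, read in the trivialization of the tangent bundle around `x₀`. -/
def bilinCoord (x₀ : M) (p : BilinTotal d M) (v w : Eu d) : ℝ :=
  p.2 ((trivializationAt (Eu d) (TangentSpace (𝓡 d)) x₀).symmL ℝ p.1 v)
    ((trivializationAt (Eu d) (TangentSpace (𝓡 d)) x₀).symmL ℝ p.1 w)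

theorem continuousAt_bilinCoord (x₀ : M) {p₀ : BilinTotal d M}
    (hp₀ : p₀.1 ∈ (trivializationAt (Eu d) (TangentSpace (𝓡 d)) x₀).baseSet) (v₀ w₀ : Eu d) :
    ContinuousAt (fun q : BilinTotal d M × Eu d × Eu d ↦ bilinCoord x₀ q.1 q.2.1 q.2.2)
      (p₀, v₀, w₀) := by
  set e := trivializationAt (Eu d) (TangentSpace (𝓡 d) (M := M)) x₀
  have hproj : Continuous (fun p : BilinTotal d M ↦ p.1) :=
    FiberBundle.continuous_proj (Eu d →L[ℝ] Eu d →L[ℝ] ℝ)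
      (fun x : M ↦ TangentSpace (𝓡 d) x →L[ℝ] TangentSpace (𝓡 d) x →L[ℝ] ℝ)
  have hbase : ∀ᶠ p in 𝓝 p₀, p.1 ∈ e.baseSet :=
    hproj.continuousAt.eventually (e.open_baseSet.mem_nhds hp₀)
  have hsec : ∀ f : Eu d × Eu d → Eu d, Continuous f →
      ContinuousAt (fun q : BilinTotal d M × Eu d × Eu d ↦
        (⟨q.1.1, e.symmL ℝ q.1.1 (f q.2)⟩ : TangentBundle (𝓡 d) M)) (p₀, v₀, w₀) := by
    intro f hf
    have h1 : ContinuousAt (fun q : BilinTotal d M × Eu d × Eu d ↦ (q.1.1, f q.2))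
        (p₀, v₀, w₀) :=
      ((hproj.comp continuous_fst).prodMk (hf.comp continuous_snd)).continuousAt
    have h2 : ContinuousAt e.toOpenPartialHomeomorph.symm (p₀.1, f (v₀, w₀)) :=
      e.toOpenPartialHomeomorph.continuousAt_symm (e.mem_target.2 hp₀)
    refine (ContinuousAt.comp (f := fun q : BilinTotal d M × Eu d × Eu d ↦ (q.1.1, f q.2))
      h2 h1).congr ?_
    filter_upwards [continuous_fst.continuousAt.eventually hbase] with q hq
    simp only [Function.comp_apply]
    rw [e.symmL_apply hq]
    exact (e.mk_symm hq _).symm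
  have h := ContinuousAt.clm_bundle_apply₂ (𝕜 := ℝ) (F₁ := Eu d) (F₂ := Eu d) (F₃ := ℝ)
    (E₁ := fun x : M ↦ TangentSpace (𝓡 d) x) (E₂ := fun x : M ↦ TangentSpace (𝓡 d) x)
    (E₃ := Bundle.Trivial M ℝ) (b := fun q : BilinTotal d M × Eu d × Eu d ↦ q.1.1)
    (ψ := fun q ↦ q.1.2) (x := (p₀, v₀, w₀)) continuous_fst.continuousAt
    (hsec _ continuous_fst) (hsec _ continuous_snd)
  simp only [FiberBundle.continuousAt_totalSpace] at h
  exact h.2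

theorem continuous_bilinTotal_proj : Continuous (fun p : BilinTotal d M ↦ p.1) :=
  FiberBundle.continuous_proj (Eu d →L[ℝ] Eu d →L[ℝ] ℝ)
    (fun x : M ↦ TangentSpace (𝓡 d) x →L[ℝ] TangentSpace (𝓡 d) x →L[ℝ] ℝ)

/-- The value of the metric `g₀`, as a point of the bundle of bilinear forms. -/
def bilinOf (g₀ : RiemMetric d M) (x : M) : BilinTotal d M := RiemMetric.toContinuousMap g₀ x

theorem continuous_bilinOf (g₀ : RiemMetric d M) : Continuous (bilinOf g₀) :=
  (RiemMetric.toContinuousMap g₀).continuous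

theorem continuousAt_bilinCoord_bilinOf (g₀ : RiemMetric d M) (x₀ : M) (v w : Eu d) :
    ContinuousAt (fun q : BilinTotal d M × Eu d × Eu d ↦
      bilinCoord x₀ (bilinOf g₀ q.1.1) q.2.1 q.2.2) (bilinOf g₀ x₀, v, w) := by
  refine ContinuousAt.comp (x := (bilinOf g₀ x₀, v, w))
    (f := fun q : BilinTotal d M × Eu d × Eu d ↦ (bilinOf g₀ q.1.1, q.2))
    (g := fun q : BilinTotal d M × Eu d × Eu d ↦ bilinCoord x₀ q.1 q.2.1 q.2.2)
    (continuousAt_bilinCoord x₀ (FiberBundle.mem_baseSet_trivializationAt' x₀) v w) ?_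
  exact (((continuous_bilinOf g₀).comp
    (continuous_bilinTotal_proj.comp continuous_fst)).prodMk continuous_snd).continuousAt

theorem bilinCoord_bilinOf_pos (g₀ : RiemMetric d M) (x₀ : M) {v : Eu d} (hv : v ≠ 0) :
    0 < bilinCoord x₀ (bilinOf g₀ x₀) v v := by
  set e := trivializationAt (Eu d) (TangentSpace (𝓡 d) (M := M)) x₀
  refine g₀.pos x₀ _ fun h0 ↦ hv ?_
  have h0' : e.symmL ℝ x₀ v = 0 := h0
  have := e.continuousLinearMapAt_symmL (R := ℝ)
    (FiberBundle.mem_baseSet_trivializationAt' x₀) v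
  rw [← this, h0', map_zero]

/-- An inequality between quadratic forms on a tangent space holds if it holds on the unit sphere
of a trivialization. -/
theorem quadratic_le_of_sphere {x₀ x : M}
    (hx : x ∈ (trivializationAt (Eu d) (TangentSpace (𝓡 d)) x₀).baseSet) {K : ℝ}
    (B B' : TangentSpace (𝓡 d) x →L[ℝ] TangentSpace (𝓡 d) x →L[ℝ] ℝ)
    (h : ∀ u ∈ Metric.sphere (0 : Eu d) 1,
      bilinCoord x₀ ⟨x, B⟩ u u ≤ K * bilinCoord x₀ ⟨x, B'⟩ u u)
    (v : TangentSpace (𝓡 d) x) : B v v ≤ K * B' v v := by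
  set e := trivializationAt (Eu d) (TangentSpace (𝓡 d) (M := M)) x₀
  let w : Eu d := e.continuousLinearMapAt ℝ x v
  have hw : e.symmL ℝ x w = v := e.symmL_continuousLinearMapAt hx v
  rcases eq_or_ne w 0 with hw0 | hw0
  · rw [hw0, map_zero] at hw
    rw [← hw]
    simp
  · have hn : ‖w‖ ≠ 0 := norm_ne_zero_iff.2 hw0
    have hu := h (‖w‖⁻¹ • w) (by simp [norm_smul, hn])
    have hs : e.symmL ℝ x (‖w‖⁻¹ • w) = ‖w‖⁻¹ • v := by rw [map_smul, hw]
    have hval : ∀ C : TangentSpace (𝓡 d) x →L[ℝ] TangentSpace (𝓡 d) x →L[ℝ] ℝ,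
        bilinCoord x₀ ⟨x, C⟩ (‖w‖⁻¹ • w) (‖w‖⁻¹ • w) = (‖w‖⁻¹) ^ 2 * C v v := by
      intro C
      change C (e.symmL ℝ x (‖w‖⁻¹ • w)) (e.symmL ℝ x (‖w‖⁻¹ • w)) = _
      rw [hs, map_smul, map_smul, smul_apply, smul_eq_mul, smul_eq_mul]
      ring
    rw [hval, hval, mul_left_comm] at hu
    exact le_of_mul_le_mul_left hu (by positivity)

/-- For `K > 1`, bilinear forms near the value of `g₀` at `x₀` have quadratic forms within the
factor `K` of that of `g₀` at the respective base point. -/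
theorem eventually_quadratic_le (g₀ : RiemMetric d M) {K : ℝ} (hK : 1 < K) (x₀ : M) :
    ∀ᶠ p in 𝓝 (bilinOf g₀ x₀), (∀ v, g₀.inner p.1 v v ≤ K * p.2 v v) ∧
      (∀ v, p.2 v v ≤ K * g₀.inner p.1 v v) := by
  set e := trivializationAt (Eu d) (TangentSpace (𝓡 d) (M := M)) x₀
  have hx₀ : x₀ ∈ e.baseSet := FiberBundle.mem_baseSet_trivializationAt' x₀
  have hbase : ∀ᶠ p in 𝓝 (bilinOf g₀ x₀), p.1 ∈ e.baseSet :=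
    continuous_bilinTotal_proj.continuousAt.eventually (e.open_baseSet.mem_nhds hx₀)
  have hdiag : ∀ v : Eu d, ContinuousAt (fun q : BilinTotal d M × Eu d ↦ (q.1, q.2, q.2))
      (bilinOf g₀ x₀, v) := fun v ↦ by fun_prop
  -- The unit sphere is compact, so that the strict inequalities at `x₀` persist nearby.
  have hS := isCompact_sphere (0 : Eu d) 1
  have h1 : ∀ᶠ p in 𝓝 (bilinOf g₀ x₀), ∀ v ∈ Metric.sphere (0 : Eu d) 1,
      bilinCoord x₀ (bilinOf g₀ p.1) v v < K * bilinCoord x₀ p v v ∧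
      bilinCoord x₀ p v v < K * bilinCoord x₀ (bilinOf g₀ p.1) v v := by
    refine hS.eventually_forall_of_forall_eventually fun v hv ↦ ?_
    have hlt : bilinCoord x₀ (bilinOf g₀ x₀) v v < K * bilinCoord x₀ (bilinOf g₀ x₀) v v :=
      lt_mul_of_one_lt_left
        (bilinCoord_bilinOf_pos g₀ x₀ (Metric.ne_of_mem_sphere hv one_ne_zero)) hK
    have cF := ContinuousAt.comp (f := fun q : BilinTotal d M × Eu d ↦ (q.1, q.2, q.2))
      (continuousAt_bilinCoord x₀ (p₀ := bilinOf g₀ x₀) hx₀ v v) (hdiag v)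
    have cG := ContinuousAt.comp (f := fun q : BilinTotal d M × Eu d ↦ (q.1, q.2, q.2))
      (continuousAt_bilinCoord_bilinOf g₀ x₀ v v) (hdiag v)
    exact (cG.eventually_lt (cF.const_mul K) hlt).and (cF.eventually_lt (cG.const_mul K) hlt)
  filter_upwards [hbase, h1] with p hp hp1
  exact ⟨quadratic_le_of_sphere hp (g₀.inner p.1) p.2 fun u hu ↦ (hp1 u hu).1.le,
    quadratic_le_of_sphere hp p.2 (g₀.inner p.1) fun u hu ↦ (hp1 u hu).2.le⟩

/-- For `K > 1`, bilinear forms near the value of `g₀` at `x₀` have Gram determinants within the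
factor `K` of that of `g₀` at the respective base point. The determinant is only continuous in a
trivialization; passing to it multiplies both sides by the same square. -/
theorem eventually_gramDet_le (g₀ : RiemMetric d M) {K : ℝ} (hK : 1 < K) (x₀ : M) :
    ∀ᶠ p in 𝓝 (bilinOf g₀ x₀), detAt g₀ p.1 ≤ K * gramDet (d := d) p.2 ∧
      gramDet (d := d) p.2 ≤ K * detAt g₀ p.1 := by
  set e := trivializationAt (Eu d) (TangentSpace (𝓡 d) (M := M)) x₀
  have hx₀ : x₀ ∈ e.baseSet := FiberBundle.mem_baseSet_trivializationAt' x₀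
  let D : BilinTotal d M → ℝ := fun p ↦ Matrix.det (Matrix.of fun i j : Fin d ↦
    bilinCoord x₀ p (EuclideanSpace.single i 1) (EuclideanSpace.single j 1))
  have hD : ∀ p : BilinTotal d M, D p =
      (LinearMap.det ((show Eu d →L[ℝ] Eu d from e.symmL ℝ p.1) : Eu d →ₗ[ℝ] Eu d)) ^ 2 *
        gramDet (d := d) p.2 := fun p ↦ det_gram_comp (d := d) p.2 (e.symmL ℝ p.1)
  have cD : ContinuousAt D (bilinOf g₀ x₀) := by
    simp only [D, Matrix.det_apply', Matrix.of_apply]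
    refine tendsto_finsetSum _ fun τ _ ↦
      tendsto_const_nhds.mul (tendsto_finsetProd _ fun i _ ↦ ?_)
    exact ContinuousAt.comp (f := fun p : BilinTotal d M ↦
      (p, EuclideanSpace.single (τ i) (1 : ℝ), EuclideanSpace.single i (1 : ℝ)))
      (continuousAt_bilinCoord x₀ (p₀ := bilinOf g₀ x₀) hx₀ _ _) (by fun_prop)
  have cD' : ContinuousAt (fun p : BilinTotal d M ↦ D (bilinOf g₀ p.1)) (bilinOf g₀ x₀) :=
    ContinuousAt.comp (x := bilinOf g₀ x₀) (f := fun p : BilinTotal d M ↦ bilinOf g₀ p.1)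
      (g := D) cD ((continuous_bilinOf g₀).comp continuous_bilinTotal_proj).continuousAt
  have hDpos : 0 < D (bilinOf g₀ x₀) := by
    have hs := g₀.symm x₀
    let B : Eu d →L[ℝ] Eu d →L[ℝ] ℝ := g₀.inner x₀
    let A : Eu d →L[ℝ] Eu d := e.symmL ℝ x₀
    exact gramDet_pos (B.bilinearComp A A) (fun v w ↦ hs _ _)
      fun v hv ↦ bilinCoord_bilinOf_pos g₀ x₀ hv
  have hlt : D (bilinOf g₀ x₀) < K * D (bilinOf g₀ x₀) := lt_mul_of_one_lt_left hDpos hK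
  have cancel : ∀ {t a b : ℝ}, t ^ 2 * a < K * (t ^ 2 * b) → a ≤ K * b := by
    intro t a b hab
    rw [mul_left_comm] at hab
    exact (lt_of_mul_lt_mul_left hab (sq_nonneg t)).le
  filter_upwards [cD'.eventually_lt (cD.const_mul K) hlt,
    cD.eventually_lt (cD'.const_mul K) hlt] with p hp2 hp3
  rw [hD, hD] at hp2 hp3
  exact ⟨cancel hp2, cancel hp3⟩

theorem eventually_areClose [CompactSpace M] (g₀ : RiemMetric d M) {L : ℝ} (hL : 1 < L) :
    ∀ᶠ g in 𝓝 g₀, AreClose d M L g₀ g := by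
  have hL2 : 1 < L ^ 2 := one_lt_pow₀ hL two_ne_zero
  let U : Set (BilinTotal d M) := {p |
    ((∀ v, g₀.inner p.1 v v ≤ L ^ 2 * p.2 v v) ∧ (∀ v, p.2 v v ≤ L ^ 2 * g₀.inner p.1 v v)) ∧
    detAt g₀ p.1 ≤ L ^ 2 * gramDet (d := d) p.2 ∧ gramDet (d := d) p.2 ≤ L ^ 2 * detAt g₀ p.1}
  have hU : ∀ x₀, U ∈ 𝓝 (bilinOf g₀ x₀) := fun x₀ ↦
    (eventually_quadratic_le g₀ hL2 x₀).and (eventually_gramDet_le g₀ hL2 x₀)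
  have hmaps : ∀ᶠ f : C(M, BilinTotal d M) in 𝓝 (RiemMetric.toContinuousMap g₀),
      MapsTo f univ (interior U) :=
    ContinuousMap.eventually_mapsTo isCompact_univ isOpen_interior
      fun x _ ↦ mem_interior_iff_mem_nhds.2 (hU x)
  have hcont : Continuous (RiemMetric.toContinuousMap (d := d) (M := M)) :=
    continuous_induced_dom
  filter_upwards [hcont.continuousAt.eventually hmaps] with g hg
  have hg' : ∀ x, RiemMetric.toContinuousMap g x ∈ U := fun x ↦ interior_subset (hg (mem_univ x))
  exact ⟨fun x ↦ (hg' x).1.1, fun x ↦ (hg' x).1.2, fun x ↦ (hg' x).2.1, fun x ↦ (hg' x).2.2⟩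

/-! ### Comparison of the min-max values -/

variable [MeasurableSpace M]

/-- A sweepout can only exist if the volume is finite: the times at which the volume is finite form
an open and closed set by flat continuity, and the volume vanishes at time `0`. -/
theorem IsSweepout.vol_univ_lt_top {g : RiemMetric d M} {φ : I → Set M} (hφ : IsSweepout g φ) :
    vol g univ < ⊤ := by
  have htri : ∀ s t : I, vol g (φ s) ≤ vol g (φ t) + flatDist g (φ s) (φ t) := fun s t ↦
    (measure_mono (by rw [symmDiff_def]; intro x hx; by_cases h : x ∈ φ t <;> simp [h, hx])).trans
      (measure_union_le _ _)
  have hev : ∀ t₀, ∀ᶠ t in 𝓝 t₀, flatDist g (φ t) (φ t₀) < ⊤ := fun t₀ ↦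
    (hφ.flat_continuous t₀).eventually (eventually_lt_nhds ENNReal.zero_lt_top)
  have hclopen : IsClopen {t | vol g (φ t) < ⊤} := by
    refine ⟨isOpen_compl_iff.1 (isOpen_iff_mem_nhds.2 fun t₀ ht₀ ↦ ?_),
      isOpen_iff_mem_nhds.2 fun t₀ ht₀ ↦ ?_⟩
    · filter_upwards [hev t₀] with t ht h
      refine ht₀ ((htri t₀ t).trans_lt (ENNReal.add_lt_top.2 ⟨h, ?_⟩))
      rwa [flatDist, symmDiff_comm]
    · filter_upwards [hev t₀] with t ht
      exact (htri t t₀).trans_lt (ENNReal.add_lt_top.2 ⟨ht₀, ht⟩)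
  have h0 : (0 : I) ∈ {t | vol g (φ t) < ⊤} := by
    simp [measure_congr hφ.zero]
  have h1 : (1 : I) ∈ {t | vol g (φ t) < ⊤} := by
    rw [hclopen.eq_univ ⟨0, h0⟩]
    trivial
  rw [← measure_congr hφ.one]
  exact h1

variable [BorelSpace M]

namespace AreClose

variable {c L : ℝ} {g g' : RiemMetric d M}

theorem vol_univ_toReal_le (hL : 0 ≤ L) (h : AreClose d M L g g') (hv : vol g univ < ⊤) :
    (vol g' univ).toReal ≤ L * (vol g univ).toReal := by
  have := ENNReal.toReal_mono (ENNReal.mul_lt_top ENNReal.ofReal_lt_top hv).ne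
    (h.vol_le hL univ)
  rwa [ENNReal.toReal_mul, ENNReal.toReal_ofReal hL] at this

/-- The error term comes from `vol g' Ω ≥ L⁻¹ vol g Ω` and `mass g' Ω ≤ L ^ 2 mass g Ω`. Finiteness
of the volume matters, since `Ac` uses the real value of the volume. -/
theorem Ac_le (hc : 0 ≤ c) (hL : 1 ≤ L) (h : AreClose d M L g g') (hv : vol g univ < ⊤)
    {Ω : Set M} (hΩ : IsCaccioppoli g Ω) :
    Ac c g' Ω ≤ L ^ 2 * Ac c g Ω + c * (L ^ 2 - L⁻¹) * (vol g univ).toReal := by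
  have hL0 : 0 < L := by positivity
  have hm : (mass g' Ω).toReal ≤ L ^ 2 * (mass g Ω).toReal := by
    have := ENNReal.toReal_mono (ENNReal.mul_lt_top ENNReal.ofReal_lt_top hΩ.2).ne
      (h.mass_le hL0 hΩ.1)
    rwa [ENNReal.toReal_mul, ENNReal.toReal_ofReal (sq_nonneg L)] at this
  have hv' : vol g' univ < ⊤ :=
    (h.vol_le hL0.le univ).trans_lt (ENNReal.mul_lt_top ENNReal.ofReal_lt_top hv)
  have hvol : (vol g Ω).toReal ≤ L * (vol g' Ω).toReal := by
    have := ENNReal.toReal_mono (ENNReal.mul_lt_top ENNReal.ofReal_lt_top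
      ((measure_mono (subset_univ Ω)).trans_lt hv')).ne (h.symm.vol_le hL0.le Ω)
    rwa [ENNReal.toReal_mul, ENNReal.toReal_ofReal hL0.le] at this
  have hmono : (vol g Ω).toReal ≤ (vol g univ).toReal :=
    ENNReal.toReal_mono hv.ne (measure_mono (subset_univ Ω))
  have hvol' : L⁻¹ * (vol g Ω).toReal ≤ (vol g' Ω).toReal := (inv_mul_le_iff₀ hL0).2 hvol
  have hcoef : 0 ≤ c * (L ^ 2 - L⁻¹) :=
    mul_nonneg hc (sub_nonneg.2 ((inv_le_one_of_one_le₀ hL).trans (one_le_pow₀ hL)))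
  rw [Ac, Ac]
  calc (mass g' Ω).toReal - c * (vol g' Ω).toReal
      ≤ L ^ 2 * (mass g Ω).toReal - c * (L⁻¹ * (vol g Ω).toReal) :=
        sub_le_sub hm (mul_le_mul_of_nonneg_left hvol' hc)
    _ = L ^ 2 * ((mass g Ω).toReal - c * (vol g Ω).toReal) +
        c * (L ^ 2 - L⁻¹) * (vol g Ω).toReal := by ring
    _ ≤ _ := by gcongr

/-- The bound is stated for real `a` above the min-max value, so that infinite values need no
separate treatment. -/
theorem minMaxValue_le (hc : 0 ≤ c) (hL : 1 ≤ L) (h : AreClose d M L g g') {a : ℝ}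
    (ha : minMaxValue c g < a) :
    vol g univ < ⊤ ∧ minMaxValue c g' ≤
      ((L ^ 2 * a + c * (L ^ 2 - L⁻¹) * (vol g univ).toReal : ℝ) : EReal) := by
  simp only [minMaxValue, iInf_lt_iff] at ha
  obtain ⟨φ, hφ, hlt⟩ := ha
  have hv := hφ.vol_univ_lt_top
  refine ⟨hv, (iInf₂_le φ (h.isSweepout (by positivity) hφ)).trans (iSup_le fun t ↦ ?_)⟩
  have hAt : Ac c g (φ t) ≤ a := EReal.coe_le_coe_iff.1 ((le_iSup (fun t : I ↦
    ((Ac c g (φ t) : ℝ) : EReal)) t).trans hlt.le)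
  refine EReal.coe_le_coe_iff.2 ((h.Ac_le hc hL hv (hφ.caccioppoli t)).trans ?_)
  gcongr

end AreClose

/-- The comparison constants tend to the identity as `L` decreases to `1`. The factor `L * V` stands
for the volume of a nearby metric, bounded in terms of that of the fixed one. -/
theorem exists_one_lt_factor (c V : ℝ) {a b : ℝ} (hab : a < b) :
    ∃ L : ℝ, 1 < L ∧ L ^ 2 * a + c * (L ^ 2 - L⁻¹) * (L * V) < b := by
  have hcont : ContinuousAt (fun L : ℝ ↦ L ^ 2 * a + c * (L ^ 2 - L⁻¹) * (L * V)) 1 := by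
    fun_prop (disch := norm_num)
  have hev := hcont.eventually (eventually_lt_nhds (b := b) (by simpa using hab))
  obtain ⟨L, hL, hL1⟩ := ((hev.filter_mono nhdsWithin_le_nhds).and
    (self_mem_nhdsWithin : Ioi (1 : ℝ) ∈ 𝓝[>] 1)).exists
  exact ⟨L, hL1, hL⟩

end CMC
end

theorem proposition3p3 (n : ℕ) (hn : 3 ≤ n + 1) (hn' : n + 1 ≤ 7)
    {M : Type*} [TopologicalSpace M] [T2Space M] [CompactSpace M]
    [ChartedSpace (EuclideanSpace ℝ (Fin (n + 1))) M] [IsManifold (𝓡 (n + 1)) ∞ M]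
    [MeasurableSpace M] [BorelSpace M] (c : ℝ) (hc : 0 < c) :
    Continuous (fun g : CMC.RiemMetric (n + 1) M ↦ CMC.minMaxValue c g) := by
  refine continuous_iff_continuousAt.2 fun g₀ ↦ tendsto_order.2 ⟨fun b hb ↦ ?_, fun b hb ↦ ?_⟩
  -- Lower semicontinuity: a value `≤ b < a` at `g` would bound the value at `g₀` by `a' < W(g₀)`.
  · obtain ⟨a, hba, ha⟩ := EReal.lt_iff_exists_real_btwn.1 hb
    obtain ⟨a', haa', ha'⟩ := EReal.lt_iff_exists_real_btwn.1 ha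
    obtain ⟨L, hL, hLa⟩ := CMC.exists_one_lt_factor c (CMC.vol g₀ univ).toReal
      (EReal.coe_lt_coe_iff.1 haa')
    have hL0 : 0 ≤ L := zero_le_one.trans hL.le
    filter_upwards [CMC.eventually_areClose g₀ hL] with g hg
    by_contra! hgb
    obtain ⟨hv, hW⟩ := hg.symm.minMaxValue_le hc.le hL.le (hgb.trans_lt hba)
    have hv₀ : CMC.vol g₀ univ < ⊤ :=
      (hg.symm.vol_le hL0 univ).trans_lt (ENNReal.mul_lt_top ENNReal.ofReal_lt_top hv)
    have hvol := hg.vol_univ_toReal_le hL0 hv₀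
    refine lt_irrefl _ ((hW.trans (EReal.coe_le_coe_iff.2 ?_)).trans_lt ha')
    have hcoef : 0 ≤ c * (L ^ 2 - L⁻¹) := mul_nonneg hc.le
      (sub_nonneg.2 ((inv_le_one_of_one_le₀ hL.le).trans (one_le_pow₀ hL.le)))
    exact (add_le_add_right (mul_le_mul_of_nonneg_left hvol hcoef) _).trans hLa.le
  -- Upper semicontinuity: the value at `g₀` bounds the value at `g`.
  · obtain ⟨a, ha, hab⟩ := EReal.lt_iff_exists_real_btwn.1 hb
    obtain ⟨a', haa', hab'⟩ := EReal.lt_iff_exists_real_btwn.1 hab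
    obtain ⟨L, hL, hLa⟩ := CMC.exists_one_lt_factor c (CMC.vol g₀ univ).toReal
      (EReal.coe_lt_coe_iff.1 haa')
    filter_upwards [CMC.eventually_areClose g₀ hL] with g hg
    refine ((hg.minMaxValue_le hc.le hL.le ha).2.trans (EReal.coe_le_coe_iff.2 ?_)).trans_lt hab'
    have hcoef : 0 ≤ c * (L ^ 2 - L⁻¹) := mul_nonneg hc.le
      (sub_nonneg.2 ((inv_le_one_of_one_le₀ hL.le).trans (one_le_pow₀ hL.le)))
    exact (add_le_add_right (mul_le_mul_of_nonneg_left
      (le_mul_of_one_le_left ENNReal.toReal_nonneg hL.le) hcoef) _).trans hLa.le
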